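/- Let $n\ge 4$. A finite simple graph is called unicyclic if it is connected and has as many edges as vertices (equivalently, it is connected and contains exactly one cycle); its girth is the length of its unique cycle. For a simple graph $G$ of order $n$ let $Q(G)=D(G)+A(G)$ be its signless Laplacian matrix, where $D(G)$ is the diagonal matrix of vertex degrees and $A(G)$ the adjacency matrix, and define the signless Laplacian coefficients $\varphi_0(G),\dots,\varphi_n(G)$ by $$\det(xI-Q(G))=\sum_{i=0}^{n}(-1)^i\varphi_i(G)\,x^{n-i}.$$ Let $S_4'$ be the graph of order $n$ obtained from a cycle of length $4$ by attaching $n-4$ pendent edges at one vertex of the cycle. Then $S_4'$ is a unicyclic graph of even girth, and for every unicyclic graph $G$ of order $n$ with even girth, $$\varphi_i(S_4')\le\varphi_i(G)\qquad\text{for all } i=0,1,\dots,n.$$ -/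

import Mathlib

namespace SimpleGraph

section

variable {V : Type*} [Fintype V] [DecidableEq V]

/-- The signless Laplacian matrix `Q(G) = D(G) + A(G)`. -/
def signlessLapMatrix (G : SimpleGraph V) [DecidableRel G.Adj] : Matrix V V ℝ :=
  G.degMatrix ℝ + G.adjMatrix ℝ

/-- The signless Laplacian coefficient `φ_i(G)`, for `0 ≤ i ≤ n = |V|`, determined by
`det (x I - Q(G)) = ∑ i, (-1) ^ i * φ_i(G) * x ^ (n - i)`. -/
noncomputable def signlessLapCoeff (G : SimpleGraph V) [DecidableRel G.Adj] (i : ℕ) : ℝ :=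
  (-1) ^ i * G.signlessLapMatrix.charpoly.coeff (Fintype.card V - i)

/-- A finite graph is unicyclic if it is connected and has as many edges as vertices
(equivalently, it is connected and contains exactly one cycle). -/
def IsUnicyclic (G : SimpleGraph V) [DecidableRel G.Adj] : Prop :=
  G.Connected ∧ G.edgeFinset.card = Fintype.card V

end

end SimpleGraph

/-- The graph `S_4'` on the vertices `0, …, n - 1`, for `n ≥ 4`: the 4-cycle `0 1 2 3`
together with the `n - 4` pendent edges joining `0` to the vertices `4, …, n - 1`. -/
def pendentC4 (n : ℕ) : SimpleGraph (Fin n) :=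
  SimpleGraph.fromRel fun a b =>
    (a.val = 0 ∧ b.val = 1) ∨ (a.val = 1 ∧ b.val = 2) ∨ (a.val = 2 ∧ b.val = 3) ∨
      (a.val = 3 ∧ b.val = 0) ∨ (a.val = 0 ∧ 4 ≤ b.val)

instance pendentC4.decidableRelAdj (n : ℕ) : DecidableRel (pendentC4 n).Adj := fun a b =>
  decidable_of_iff _ (SimpleGraph.fromRel_adj _ a b).symm

/-! A unicyclic graph has a parent map `h` (once around the cycle, otherwise towards it) whose pairs
`{v, h v}` are exactly the edges, so edges are indexed by vertices. With `B` the incidence matrix,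
`Q = B Bᵀ` has the same characteristic polynomial as `Bᵀ B`; hence `φ_i` is the sum of the principal
minors of `Bᵀ B` over the `i`-sets `F` of edges (`signlessLapCoeff_eq_sum`).

If `F` misses a cycle edge it is a forest, each component rooted at the point where orbits leave
`F`, and its minor is `∏ (1 + c_r)`, where `c_r` counts the edges of the component of `r`
(`det_gram_eq_prod`). This is at least `1 + e₁(c) + e₂(c)`, where `e₁(c) = |F|` and `e₂(c)` is half
the number of ordered pairs of edges of `F` in distinct components (`le_det_gram`). If `F` contains
the cycle, its minor is nonnegative.

Summing over `F` and exchanging summations leaves a count, for each pair of edges, of the sets `F`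
separating it. Following orbits around the cycle bounds the total from below when the girth is at
least 4 (`le_sum_separationCount`), which gives `unicyclicBound`.

For `pendentC4` every estimate is sharp: at most two of the `c_r` are nonzero, minors with the whole
cycle vanish, and only the pairs used in the bound can be separated. Parity of the girth serves to
exclude triangles. -/

open Finset Matrix

/-! ### Exit points of orbits -/

section ExitPoint

variable {V : Type*}

/-- The number of steps that the orbit of `v` under `h` needs to leave `F`. -/
noncomputable def exitTime (h : V → V) (F : Finset V) (v : V) : ℕ :=
  sInf {k | h^[k] v ∉ F}

/-- The first point outside `F` on the orbit of `v` under `h`. -/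
noncomputable def exitPt (h : V → V) (F : Finset V) (v : V) : V :=
  h^[exitTime h F v] v

variable {h : V → V} {F : Finset V} {v : V}

theorem exitTime_le {k : ℕ} (hk : h^[k] v ∉ F) : exitTime h F v ≤ k :=
  Nat.sInf_le hk

theorem exitPt_notMem (hF : ∃ k, h^[k] v ∉ F) : exitPt h F v ∉ F :=
  Nat.sInf_mem (s := {k | h^[k] v ∉ F}) hF

theorem exitTime_of_notMem (hv : v ∉ F) : exitTime h F v = 0 :=
  Nat.le_zero.1 (exitTime_le (k := 0) hv)

theorem exitPt_of_notMem (hv : v ∉ F) : exitPt h F v = v := by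
  simp [exitPt, exitTime_of_notMem hv]

theorem exitTime_of_mem (hF : ∃ k, h^[k] v ∉ F) (hv : v ∈ F) :
    exitTime h F v = exitTime h F (h v) + 1 := by
  have h1 := exitPt_notMem hF
  unfold exitPt at h1
  apply le_antisymm
  · apply exitTime_le
    rw [Function.iterate_succ_apply]
    apply exitPt_notMem
    obtain ⟨k, hk⟩ := hF
    cases k with
    | zero => exact absurd hv hk
    | succ k => exact ⟨k, by rwa [Function.iterate_succ_apply] at hk⟩
  · cases hk : exitTime h F v with
    | zero => rw [hk] at h1; exact absurd hv h1
    | succ k =>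
      rw [hk, Function.iterate_succ_apply] at h1
      exact Nat.succ_le_succ (exitTime_le h1)

theorem exitPt_of_mem (hF : ∃ k, h^[k] v ∉ F) (hv : v ∈ F) :
    exitPt h F v = exitPt h F (h v) := by
  rw [exitPt, exitTime_of_mem hF hv, Function.iterate_succ_apply, exitPt]

theorem exists_exitPt_eq_iterate {k : ℕ} (hk : h^[k] v ∉ F) :
    ∃ s ≤ k, exitPt h F v = h^[s] v :=
  ⟨_, exitTime_le hk, rfl⟩

end ExitPoint

/-- The left side is the part of degree at most two in the expansion of the product; the terms
dropped are nonnegative. -/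
theorem prod_one_add_ge {ι : Type*} (s : Finset ι) (c : ι → ℝ) (hc : ∀ i, 0 ≤ c i) :
    1 + ∑ i ∈ s, c i + ((∑ i ∈ s, c i) ^ 2 - ∑ i ∈ s, c i ^ 2) / 2 ≤ ∏ i ∈ s, (1 + c i) := by
  classical
  induction s using Finset.induction_on with
  | empty => simp
  | insert a s ha ih =>
    rw [sum_insert ha, sum_insert ha, prod_insert ha]
    have h1 : 1 + ∑ i ∈ s, c i ≤ ∏ i ∈ s, (1 + c i) := by
      refine le_trans ?_ ih
      have := sum_sq_le_sq_sum_of_nonneg (s := s) (f := c) fun i _ => hc i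
      linarith
    nlinarith [mul_le_mul_of_nonneg_left h1 (hc a)]

/-! ### Principal minors of the Gram matrix of a forest -/

section GramDet

variable {V : Type*} [DecidableEq V]

/-- The incidence matrix of the graph with edges `{v, h v}`, whose column `v` belongs to the edge
`{v, h v}`. -/
def parentIncMatrix (h : V → V) : Matrix V V ℝ :=
  of fun w v => (if w = v then 1 else 0) + (if w = h v then 1 else 0)

/-- Column `v` is supported on the rows `v` and `h v`, and `h v` leaves `F` one step sooner;
ordering by exit time makes the matrix unitriangular. -/
theorem det_parentIncMatrix_submatrix {h : V → V} {F : Finset V}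
    (hF : ∀ v, ∃ k, h^[k] v ∉ F) :
    ((parentIncMatrix h).submatrix (Subtype.val : F → V) Subtype.val).det = 1 := by
  set U := (parentIncMatrix h).submatrix (Subtype.val : F → V) Subtype.val
  have hne : ∀ v ∈ F, exitTime h F (h v) < exitTime h F v := fun v hv => by
    rw [exitTime_of_mem (hF v) hv]; omega
  have hU : BlockTriangular U (fun v : F => exitTime h F v) := by
    intro w v hvw
    have h1 : (w : V) ≠ v := by
      intro e
      rw [Subtype.ext e] at hvw
      exact lt_irrefl _ hvw
    have h2 : (w : V) ≠ h v := by
      intro e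
      have := hne v v.2
      rw [← e] at this
      exact absurd hvw this.not_gt
    simp [U, parentIncMatrix, h1, h2]
  rw [hU.det]
  refine prod_eq_one fun k _ => ?_
  have : U.toSquareBlock (fun v : F => exitTime h F v) k = 1 := by
    ext ⟨w, hw⟩ ⟨v, hv⟩
    have h2 : (w : V) ≠ h v := by
      intro e
      have := hne v v.2
      rw [← e] at this
      omega
    change (if (w : V) = v then (1 : ℝ) else 0) + (if (w : V) = h v then 1 else 0) = _
    rw [if_neg h2, add_zero, one_apply]
    simp only [Subtype.mk.injEq, SetLike.coe_eq_coe]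
  rw [this, det_one]

/-- The ordered pairs in `F` whose edges lie in distinct components. -/
noncomputable def separatedPairs (h : V → V) (F : Finset V) : Finset (V × V) :=
  (F ×ˢ F).filter fun p => exitPt h F p.1 ≠ exitPt h F p.2

variable [Fintype V]

/-- Split the rows of `B` into those in `F`, forming the unimodular `U`, and those outside, which
equal `W * U`. The Gram matrix is then `Uᵀ (1 + Wᵀ W) U`, and `det (1 + Wᵀ W) = det (1 + W Wᵀ)` with
`W Wᵀ` diagonal. -/
theorem det_gram_eq_prod {h : V → V} {F : Finset V} (hF : ∀ v, ∃ k, h^[k] v ∉ F) :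
    (((parentIncMatrix h)ᵀ * parentIncMatrix h).submatrix
      (Subtype.val : F → V) Subtype.val).det =
      ∏ r : V, (1 + ((F.filter (exitPt h F · = r)).card : ℝ)) := by
  set U := (parentIncMatrix h).submatrix (Subtype.val : F → V) Subtype.val with hU
  -- The alternating signs make the contributions of `b` and `h b` to column `b` cancel while `h b`
  -- is still in `F`; only the last edge before the exit reaches the root row.
  let W : Matrix V F ℝ :=
    of fun r v => if exitPt h F v = r then (-1) ^ (exitTime h F v + 1) else 0
  have hWU : ∀ r (b : F), (W * U) r b = if r ∈ F then 0 else parentIncMatrix h r b := by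
    intro r b
    have key : (W * U) r b = ∑ w ∈ F, (if exitPt h F w = r then
        (-1 : ℝ) ^ (exitTime h F w + 1) else 0) * parentIncMatrix h w b := by
      rw [mul_apply, ← sum_coe_sort F]
      rfl
    rw [key]
    simp only [parentIncMatrix, of_apply, mul_add, sum_add_distrib, mul_ite, mul_one, mul_zero,
      sum_ite_eq', b.2, if_true]
    rw [exitPt_of_mem (v := (b : V)) (hF b) b.2, exitTime_of_mem (v := (b : V)) (hF b) b.2]
    by_cases hb : h b ∈ F
    · rw [if_pos hb]
      by_cases hr : exitPt h F (h b) = r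
      · have hrF : r ∉ F := hr ▸ exitPt_notMem (hF _)
        have h1 : r ≠ b := by rintro rfl; exact hrF b.2
        have h2 : r ≠ h b := by rintro rfl; exact hrF hb
        simp [hr, hrF, h1, h2, pow_succ]
      · by_cases hrF : r ∈ F
        · simp [hr, hrF]
        · have h1 : r ≠ b := by rintro rfl; exact hrF b.2
          have h2 : r ≠ h b := by rintro rfl; exact hrF hb
          simp [hr, hrF, h1, h2]
    · rw [if_neg hb, exitPt_of_notMem hb, exitTime_of_notMem hb]
      by_cases hr : h b = r
      · subst hr
        have h1 : h b ≠ b := fun e => hb (by rw [e]; exact b.2)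
        simp [hb, h1]
      · by_cases hrF : r ∈ F
        · simp [hr, hrF]
        · have h1 : r ≠ b := by rintro rfl; exact hrF b.2
          simp [hr, hrF, h1, Ne.symm hr]
  have hgram : ((parentIncMatrix h)ᵀ * parentIncMatrix h).submatrix
      (Subtype.val : F → V) Subtype.val = Uᵀ * (1 + Wᵀ * W) * U := by
    have : Uᵀ * (1 + Wᵀ * W) * U = Uᵀ * U + (W * U)ᵀ * (W * U) := by
      rw [transpose_mul]; simp only [Matrix.mul_add, Matrix.add_mul, Matrix.mul_one,
        Matrix.mul_assoc]
    rw [this]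
    ext a b
    rw [submatrix_apply, Matrix.add_apply, mul_apply, mul_apply, mul_apply]
    simp only [transpose_apply, hWU]
    have h1 : ∑ x : F, U x a * U x b = ∑ x ∈ F, parentIncMatrix h x a * parentIncMatrix h x b := by
      rw [← sum_coe_sort F]; rfl
    have h2 : ∑ r, (if r ∈ F then 0 else parentIncMatrix h r a) *
        (if r ∈ F then 0 else parentIncMatrix h r b) =
        ∑ x ∈ Fᶜ, parentIncMatrix h x a * parentIncMatrix h x b := by
      rw [← sum_filter_add_sum_filter_not univ (· ∈ F)]
      rw [sum_eq_zero (by intro x hx; simp at hx; simp [hx]), zero_add]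
      refine sum_congr (by ext; simp) fun x hx => ?_
      simp at hx; simp [hx]
    rw [h1, h2, sum_add_sum_compl]
  have hWW : W * Wᵀ = diagonal fun r => ((F.filter (exitPt h F · = r)).card : ℝ) := by
    ext r s
    have key : (W * Wᵀ) r s = ∑ v ∈ F, (if exitPt h F v = r then
        (-1 : ℝ) ^ (exitTime h F v + 1) else 0) * (if exitPt h F v = s then
        (-1 : ℝ) ^ (exitTime h F v + 1) else 0) := by
      rw [mul_apply, ← sum_coe_sort F]
      rfl
    rw [key]
    by_cases hrs : r = s
    · subst hrs
      rw [diagonal_apply_eq, card_filter]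
      push_cast
      refine sum_congr rfl fun v _ => ?_
      split_ifs
      · rw [← mul_pow]; simp
      · simp
    · rw [diagonal_apply_ne _ hrs]
      refine sum_eq_zero fun v _ => ?_
      split_ifs with h1 h2
      · exact absurd (h1.symm.trans h2) hrs
      all_goals simp
  rw [hgram, det_mul, det_mul, det_transpose, det_parentIncMatrix_submatrix hF, one_mul, mul_one,
    det_one_add_mul_comm, hWW, ← diagonal_one, diagonal_add, det_diagonal]

theorem det_gram_nonneg (h : V → V) (F : Finset V) :
    0 ≤ (((parentIncMatrix h)ᵀ * parentIncMatrix h).submatrix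
      (Subtype.val : F → V) Subtype.val).det := by
  have := (posSemidef_conjTranspose_mul_self (parentIncMatrix h)).submatrix (Subtype.val : F → V)
  simpa [conjTranspose_eq_transpose_of_trivial] using this.det_nonneg

theorem card_separatedPairs (h : V → V) (F : Finset V) :
    ((separatedPairs h F).card : ℝ) = (F.card : ℝ) ^ 2 -
      ∑ r : V, ((F.filter (exitPt h F · = r)).card : ℝ) ^ 2 := by
  have h1 : ((F ×ˢ F).filter fun p => exitPt h F p.1 = exitPt h F p.2).card =
      ∑ r : V, (F.filter (exitPt h F · = r)).card ^ 2 := by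
    rw [card_eq_sum_card_fiberwise (f := fun p => exitPt h F p.1) (t := univ) (by simp [Set.MapsTo])]
    refine sum_congr rfl fun r _ => ?_
    rw [sq, ← card_product]
    congr 1
    ext ⟨a, b⟩
    simp only [mem_filter, mem_product]
    constructor
    · rintro ⟨⟨⟨ha, hb⟩, hab⟩, hr⟩; exact ⟨⟨ha, hr⟩, hb, hab ▸ hr⟩
    · rintro ⟨⟨ha, hr⟩, hb, hr'⟩; exact ⟨⟨⟨ha, hb⟩, hr.trans hr'.symm⟩, hr⟩
  have h2 := card_filter_add_card_filter_not (s := F ×ˢ F)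
    (fun p => exitPt h F p.1 = exitPt h F p.2)
  rw [h1, card_product] at h2
  have h3 : ((∑ r : V, (F.filter (exitPt h F · = r)).card ^ 2 : ℕ) : ℝ) +
      ((separatedPairs h F).card : ℝ) = (F.card : ℝ) * F.card := by
    exact_mod_cast h2
  push_cast at h3
  linarith

theorem sum_card_fibers (h : V → V) (F : Finset V) :
    ∑ r : V, ((F.filter (exitPt h F · = r)).card : ℝ) = F.card := by
  rw [card_eq_sum_card_fiberwise (f := exitPt h F) (t := univ) (by simp [Set.MapsTo])]
  push_cast; rfl

theorem le_det_gram {h : V → V} {F : Finset V} (hF : ∀ v, ∃ k, h^[k] v ∉ F) :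
    1 + (F.card : ℝ) + ((separatedPairs h F).card : ℝ) / 2 ≤
      (((parentIncMatrix h)ᵀ * parentIncMatrix h).submatrix
      (Subtype.val : F → V) Subtype.val).det := by
  rw [det_gram_eq_prod hF, card_separatedPairs, ← sum_card_fibers h F]
  exact prod_one_add_ge univ _ fun r => Nat.cast_nonneg _

end GramDet

/-! ### Counting edge sets with prescribed membership -/

section Counting

variable {V : Type*} [Fintype V] [DecidableEq V]

/-- The number of `i`-subsets of an `n`-set that contain `a` given elements and avoid `b` others. -/
def avoidCount (n a b i : ℕ) : ℕ :=
  if a ≤ i then (n - a - b).choose (i - a) else 0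

theorem card_filter_subset_disjoint (A B : Finset V) (hAB : Disjoint A B) (i : ℕ) :
    ((powersetCard i univ).filter fun F => A ⊆ F ∧ Disjoint B F).card =
      avoidCount (Fintype.card V) A.card B.card i := by
  unfold avoidCount
  split_ifs with hi
  · have : Fintype.card V - A.card - B.card = ((A ∪ B)ᶜ).card := by
      rw [card_compl, card_union_of_disjoint hAB, Nat.sub_add_eq]
    rw [this, ← card_powersetCard]
    refine card_bij' (fun F _ => F \ A) (fun F _ => F ∪ A) ?_ ?_ ?_ ?_
    · intro F hF
      simp only [mem_filter, mem_powersetCard] at hF ⊢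
      obtain ⟨⟨-, hc⟩, hA, hB⟩ := hF
      refine ⟨fun x hx => ?_, by rw [card_sdiff_of_subset hA, hc]⟩
      rw [mem_sdiff] at hx
      simp only [mem_compl, mem_union, not_or]
      exact ⟨hx.2, fun h => disjoint_left.1 hB h hx.1⟩
    · intro F hF
      simp only [mem_filter, mem_powersetCard] at hF ⊢
      obtain ⟨hs, hc⟩ := hF
      have hd : Disjoint F A := disjoint_left.2 fun x hx hA => by
        have := hs hx
        simp [hA] at this
      refine ⟨⟨subset_univ _, by rw [card_union_of_disjoint hd, hc]; omega⟩,
        subset_union_right, disjoint_union_right.2 ⟨?_, hAB.symm⟩⟩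
      exact disjoint_left.2 fun x hx hF => by
        have := hs hF
        simp [hx] at this
    · intro F hF
      simp only [mem_filter, mem_powersetCard] at hF
      exact sdiff_union_of_subset hF.2.1
    · intro F hF
      simp only [mem_powersetCard] at hF
      rw [union_sdiff_right]
      refine sdiff_eq_self_of_disjoint (disjoint_left.2 fun x hx hA => ?_)
      have := hF.1 hx
      simp [hA] at this
  · rw [card_eq_zero, filter_eq_empty_iff]
    rintro F hF ⟨hA, -⟩
    rw [mem_powersetCard] at hF
    exact hi (hF.2 ▸ card_le_card hA)

theorem card_filter_mem_mem_notMem_notMem {u v x y : V} (huv : u ≠ v) (hux : u ≠ x) (huy : u ≠ y)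
    (hvx : v ≠ x) (hvy : v ≠ y) (hxy : x ≠ y) (i : ℕ) :
    ((powersetCard i (univ : Finset V)).filter
      fun F => u ∈ F ∧ v ∈ F ∧ x ∉ F ∧ y ∉ F).card = avoidCount (Fintype.card V) 2 2 i := by
  have := card_filter_subset_disjoint {u, v} {x, y}
    (by simp [hux.symm, huy.symm, hvx.symm, hvy.symm]) i
  rw [card_pair huv, card_pair hxy] at this
  rw [← this]
  congr 1
  ext F
  simp [insert_subset_iff, and_assoc]

/-- The number of `i`-subsets of an `n`-set that contain two given elements, avoid a third one, and
do not contain both of two further ones. -/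
def splitCount (n i : ℕ) : ℕ :=
  avoidCount n 2 2 i + avoidCount n 3 2 i

/-- The two summands of `splitCount` are the cases `c ∉ F`, and `c ∈ F` with `d ∉ F`. -/
theorem card_filter_mem_mem_notMem_or {u v x c d : V} (huv : u ≠ v) (hux : u ≠ x) (huc : u ≠ c)
    (hud : u ≠ d) (hvx : v ≠ x) (hvc : v ≠ c) (hvd : v ≠ d) (hxc : x ≠ c) (hxd : x ≠ d)
    (hcd : c ≠ d) (i : ℕ) :
    ((powersetCard i (univ : Finset V)).filter
      fun F => u ∈ F ∧ v ∈ F ∧ x ∉ F ∧ (c ∉ F ∨ d ∉ F)).card = splitCount (Fintype.card V) i := by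
  rw [splitCount, ← card_filter_mem_mem_notMem_notMem huv hux huc hvx hvc hxc i]
  have := card_filter_subset_disjoint {u, v, c} {x, d}
    (by simp [hux.symm, hud.symm, hvx.symm, hvd.symm, hxc, hcd.symm]) i
  rw [card_eq_three.2 ⟨u, v, c, huv, huc, hvc, rfl⟩, card_pair hxd] at this
  rw [← this, ← card_union_of_disjoint]
  · congr 1
    ext F
    simp only [mem_filter, mem_union, insert_subset_iff, singleton_subset_iff, disjoint_insert_left,
      disjoint_singleton_left]
    tauto
  · rw [disjoint_left]
    simp only [mem_filter, insert_subset_iff, singleton_subset_iff]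
    tauto

end Counting

/-! ### Separating pairs of edges along the cycle -/

section ParentCycle

variable {V : Type*}

/-- `C` is the only periodic orbit of `h`. -/
structure IsParentCycle (h : V → V) (C : Finset V) : Prop where
  map_mem : ∀ z ∈ C, h z ∈ C
  minimalPeriod_eq : ∀ z ∈ C, Function.minimalPeriod h z = C.card
  reaches : ∀ v, ∃ k, h^[k] v ∈ C

namespace IsParentCycle

variable {h : V → V} {C F : Finset V}

theorem iterate_mem (hC : IsParentCycle h C) {z : V} (hz : z ∈ C) (k : ℕ) : h^[k] z ∈ C := by
  induction k with
  | zero => exact hz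
  | succ k ih => rw [Function.iterate_succ_apply']; exact hC.map_mem _ ih

theorem iterate_inj (hC : IsParentCycle h C) {z : V} (hz : z ∈ C) {a b : ℕ} (ha : a < C.card)
    (hb : b < C.card) : h^[a] z = h^[b] z ↔ a = b := by
  rw [← hC.minimalPeriod_eq z hz] at ha hb
  exact Function.iterate_eq_iterate_iff_of_lt_minimalPeriod ha hb

/-- The orbit of `u` enters the arc `z, h z, …` at `z` and must stop by `h^[a] z`, before reaching
`h^[k] z`; the orbit of `h^[k] z` stops between `h^[k] z` and `h^[b] z`. So two gaps, one on each
side, separate the edges. -/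
theorem exitPt_ne (hC : IsParentCycle h C) {u z : V} (hz : z ∈ C) {t k m a b : ℕ}
    (hm : m ≤ C.card) (hu : h^[t] u = z) (hs : ∀ s < t, ∀ j < m, h^[s] u ≠ h^[j] z)
    (hak : a < k) (hkb : k < b) (hbm : b < m) (ha : h^[a] z ∉ F) (hb : h^[b] z ∉ F) :
    exitPt h F u ≠ exitPt h F (h^[k] z) := by
  obtain ⟨s, hsa, es⟩ : ∃ s ≤ a + t, exitPt h F u = h^[s] u :=
    exists_exitPt_eq_iterate (by rwa [Function.iterate_add_apply, hu])
  obtain ⟨r, hr, er⟩ : ∃ r ≤ b - k, exitPt h F (h^[k] z) = h^[r] (h^[k] z) :=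
    exists_exitPt_eq_iterate
      (by rwa [← Function.iterate_add_apply, Nat.sub_add_cancel hkb.le])
  rw [← Function.iterate_add_apply] at er
  rw [es, er]
  by_cases hst : s < t
  · exact hs s hst _ (by omega)
  · have : s = (s - t) + t := by omega
    rw [this, Function.iterate_add_apply, hu, Ne, hC.iterate_inj hz (by omega) (by omega)]
    omega

variable [DecidableEq V]

theorem image_iterate (hC : IsParentCycle h C) {z : V} (hz : z ∈ C) :
    (range C.card).image (h^[·] z) = C := by
  refine eq_of_subset_of_card_le ?_ ?_
  · intro w hw
    obtain ⟨k, -, rfl⟩ := mem_image.1 hw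
    exact hC.iterate_mem hz k
  · rw [card_image_of_injOn, card_range]
    intro a ha b hb hab
    exact (hC.iterate_inj hz (by simpa using ha) (by simpa using hb)).1 hab

theorem exits (hC : IsParentCycle h C) (hF : ¬ C ⊆ F) (v : V) : ∃ k, h^[k] v ∉ F := by
  obtain ⟨k, hk⟩ := hC.reaches v
  obtain ⟨w, hw, hwF⟩ := not_subset.1 hF
  rw [← hC.image_iterate hk] at hw
  obtain ⟨j, -, rfl⟩ := mem_image.1 hw
  exact ⟨j + k, by rwa [Function.iterate_add_apply]⟩

variable [Fintype V]

/-- The number of `i`-subsets of edges that miss an edge of the cycle and in which the edges of the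
given pair lie in distinct components. -/
noncomputable def _root_.separationCount (h : V → V) (C : Finset V) (i : ℕ) (p : V × V) : ℕ :=
  ((powersetCard i univ).filter fun F => ¬ C ⊆ F ∧ p ∈ separatedPairs h F).card

theorem _root_.separationCount_swap (h : V → V) (C : Finset V) (i : ℕ) (u v : V) :
    separationCount h C i (u, v) = separationCount h C i (v, u) := by
  unfold separationCount separatedPairs
  congr 1
  ext F
  simp only [mem_filter, mem_product]
  rw [ne_comm (a := exitPt h F u), and_comm (a := u ∈ F)]

/-- The gap before `h^[k] z` is fixed at `z`; the gap after it may be at either of the next two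
positions, hence `k + 3 ≤ m`. -/
theorem splitCount_le_of_gap_left (hC : IsParentCycle h C) {u z : V} (hz : z ∈ C) {t k m : ℕ}
    (hm : m ≤ C.card) (ht : 0 < t) (hu : h^[t] u = z)
    (hs : ∀ s < t, ∀ j < m, h^[s] u ≠ h^[j] z) (hk : 1 ≤ k) (hkm : k + 3 ≤ m) (i : ℕ) :
    splitCount (Fintype.card V) i ≤ separationCount h C i (u, h^[k] z) := by
  have hne : ∀ {a b}, a < m → b < m → a ≠ b → h^[a] z ≠ h^[b] z := fun ha hb hab =>
    (hC.iterate_inj hz (by omega) (by omega)).not.2 hab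
  have hu' : ∀ j < m, u ≠ h^[j] z := hs 0 ht
  rw [← card_filter_mem_mem_notMem_or (hu' k (by omega)) (hu' 0 (by omega))
    (hu' (k + 1) (by omega)) (hu' (k + 2) (by omega)) (hne (by omega) (by omega) (by omega))
    (hne (by omega) (by omega) (by omega)) (hne (by omega) (by omega) (by omega))
    (hne (by omega) (by omega) (by omega)) (hne (by omega) (by omega) (by omega))
    (hne (by omega) (by omega) (by omega)) i]
  refine card_le_card fun F hF => ?_
  simp only [mem_filter, separatedPairs, mem_product] at hF ⊢
  obtain ⟨hc, h1, h2, hx, hcd⟩ := hF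
  refine ⟨hc, fun hCF => hx (hCF (hC.iterate_mem hz _)), ⟨h1, h2⟩, ?_⟩
  rcases hcd with hy | hy
  · exact hC.exitPt_ne hz hm hu hs (by omega) (by omega) (by omega) hx hy
  · exact hC.exitPt_ne hz hm hu hs (by omega) (by omega) (by omega) hx hy

/-- Mirror case: the later gap is fixed at `h^[k + 1] z`, and the earlier one is at `z` or `h z`,
hence `2 ≤ k`. -/
theorem splitCount_le_of_gap_right (hC : IsParentCycle h C) {u z : V} (hz : z ∈ C) {t k m : ℕ}
    (hm : m ≤ C.card) (ht : 0 < t) (hu : h^[t] u = z)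
    (hs : ∀ s < t, ∀ j < m, h^[s] u ≠ h^[j] z) (hk : 2 ≤ k) (hkm : k + 2 ≤ m) (i : ℕ) :
    splitCount (Fintype.card V) i ≤ separationCount h C i (u, h^[k] z) := by
  have hne : ∀ {a b}, a < m → b < m → a ≠ b → h^[a] z ≠ h^[b] z := fun ha hb hab =>
    (hC.iterate_inj hz (by omega) (by omega)).not.2 hab
  have hu' : ∀ j < m, u ≠ h^[j] z := hs 0 ht
  rw [← card_filter_mem_mem_notMem_or (hu' k (by omega)) (hu' (k + 1) (by omega))
    (hu' 0 (by omega)) (hu' 1 (by omega)) (hne (by omega) (by omega) (by omega))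
    (hne (by omega) (by omega) (by omega)) (hne (by omega) (by omega) (by omega))
    (hne (by omega) (by omega) (by omega)) (hne (by omega) (by omega) (by omega))
    (hne (by omega) (by omega) (by omega)) i]
  refine card_le_card fun F hF => ?_
  simp only [mem_filter, separatedPairs, mem_product] at hF ⊢
  obtain ⟨hc, h1, h2, hx, hcd⟩ := hF
  refine ⟨hc, fun hCF => hx (hCF (hC.iterate_mem hz _)), ⟨h1, h2⟩, ?_⟩
  rcases hcd with hy | hy
  · exact hC.exitPt_ne hz hm hu hs (by omega) (by omega) (by omega) hy hx
  · exact hC.exitPt_ne hz hm hu hs (by omega) (by omega) (by omega) hy hx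

theorem avoidCount_le (hC : IsParentCycle h C) {u z : V} (hz : z ∈ C) {t k m : ℕ}
    (hm : m ≤ C.card) (ht : 0 < t) (hu : h^[t] u = z)
    (hs : ∀ s < t, ∀ j < m, h^[s] u ≠ h^[j] z) (hk : 1 ≤ k) (hkm : k + 2 ≤ m) (i : ℕ) :
    avoidCount (Fintype.card V) 2 2 i ≤ separationCount h C i (u, h^[k] z) := by
  have hne : ∀ {a b}, a < m → b < m → a ≠ b → h^[a] z ≠ h^[b] z := fun ha hb hab =>
    (hC.iterate_inj hz (by omega) (by omega)).not.2 hab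
  have hu' : ∀ j < m, u ≠ h^[j] z := hs 0 ht
  rw [← card_filter_mem_mem_notMem_notMem (hu' k (by omega)) (hu' 0 (by omega))
    (hu' (k + 1) (by omega)) (hne (by omega) (by omega) (by omega))
    (hne (by omega) (by omega) (by omega)) (hne (by omega) (by omega) (by omega)) i]
  refine card_le_card fun F hF => ?_
  simp only [mem_filter, separatedPairs, mem_product] at hF ⊢
  obtain ⟨hc, h1, h2, hx, hy⟩ := hF
  exact ⟨hc, fun hCF => hx (hCF (hC.iterate_mem hz _)), ⟨h1, h2⟩,
    hC.exitPt_ne hz hm hu hs (by omega) (by omega) (by omega) hx hy⟩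

theorem two_mul_splitCount_le (hC : IsParentCycle h C) (hg : 4 ≤ C.card) {u : V} (hu : u ∉ C)
    (i : ℕ) :
    2 * splitCount (Fintype.card V) i ≤ ∑ v ∈ C, separationCount h C i (u, v) := by
  classical
  have hex := hC.reaches u
  set t := Nat.find hex with ht
  have hz : h^[t] u ∈ C := Nat.find_spec hex
  have ht0 : 0 < t := by
    rcases Nat.eq_zero_or_pos t with h0 | h0
    · rw [h0] at hz; exact absurd hz hu
    · exact h0
  have hs : ∀ s < t, ∀ j < C.card, h^[s] u ≠ h^[j] (h^[t] u) := fun s hst j _ e =>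
    Nat.find_min hex hst (e ▸ hC.iterate_mem hz j)
  -- The two partners of `u` are the second and the last but one vertex of the cycle read from the
  -- entry point; they differ because the cycle has length at least 4.
  have hne : h^[1] (h^[t] u) ≠ h^[C.card - 2] (h^[t] u) :=
    (hC.iterate_inj hz (by omega) (by omega)).not.2 (by omega)
  calc 2 * splitCount (Fintype.card V) i
      ≤ separationCount h C i (u, h^[1] (h^[t] u)) +
        separationCount h C i (u, h^[C.card - 2] (h^[t] u)) := by
        rw [two_mul]
        exact add_le_add
          (hC.splitCount_le_of_gap_left hz le_rfl ht0 rfl hs le_rfl (by omega) i)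
          (hC.splitCount_le_of_gap_right hz le_rfl ht0 rfl hs (by omega) (by omega) i)
    _ = ∑ v ∈ {h^[1] (h^[t] u), h^[C.card - 2] (h^[t] u)}, separationCount h C i (u, v) :=
        (sum_pair (f := fun v => separationCount h C i (u, v)) hne).symm
    _ ≤ _ := sum_le_sum_of_subset (by
        intro w hw
        simp only [mem_insert, mem_singleton] at hw
        rcases hw with rfl | rfl <;> exact hC.iterate_mem hz _)

theorem mul_le_sum_separationCount (hC : IsParentCycle h C) (hg : 4 ≤ C.card) {u : V} (hu : u ∈ C)
    (i : ℕ) :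
    (C.card - 3) * (if C.card = 4 then avoidCount (Fintype.card V) 2 2 i else
      splitCount (Fintype.card V) i) ≤ ∑ v ∈ C, separationCount h C i (u, v) := by
  have hz := hC.map_mem u hu
  -- As `u` itself lies on the cycle, the arc starts at `h u` and is one vertex shorter. For girth 4
  -- only `k = 1` remains, with a single choice for each gap; this is why `avoidCount` replaces
  -- `splitCount`.
  have hs : ∀ s < 1, ∀ j < C.card - 1, h^[s] u ≠ h^[j] (h u) := by
    intro s hs j hj e
    obtain rfl : s = 0 := by omega
    have : h^[0] u = h^[j + 1] u := e
    rw [hC.iterate_inj hu (by omega) (by omega)] at this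
    omega
  calc _ = ∑ k ∈ Icc 1 (C.card - 3), (if C.card = 4 then avoidCount (Fintype.card V) 2 2 i else
      splitCount (Fintype.card V) i) := by simp
    _ ≤ ∑ k ∈ Icc 1 (C.card - 3), separationCount h C i (u, h^[k] (h u)) := by
        refine sum_le_sum fun k hk => ?_
        rw [mem_Icc] at hk
        split_ifs with h4
        · exact hC.avoidCount_le hz (m := C.card - 1) (by omega) one_pos rfl hs hk.1 (by omega) i
        · by_cases hk' : k + 3 ≤ C.card - 1
          · exact hC.splitCount_le_of_gap_left hz (by omega) one_pos rfl hs hk.1 hk' i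
          · exact hC.splitCount_le_of_gap_right hz (m := C.card - 1) (by omega) one_pos rfl hs
              (by omega) (by omega) i
    _ = ∑ v ∈ (Icc 1 (C.card - 3)).image (h^[·] (h u)), separationCount h C i (u, v) := by
        rw [sum_image]
        intro a ha b hb hab
        simp only [coe_Icc, Set.mem_Icc] at ha hb
        exact (hC.iterate_inj hz (by omega) (by omega)).1 hab
    _ ≤ _ := sum_le_sum_of_subset (by
        intro w hw
        obtain ⟨k, -, rfl⟩ := mem_image.1 hw
        exact hC.iterate_mem hz _)

theorem le_sum_separationCount (hC : IsParentCycle h C) (hg : 4 ≤ C.card) (i : ℕ) :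
    4 * (Fintype.card V - 4) * splitCount (Fintype.card V) i +
      4 * avoidCount (Fintype.card V) 2 2 i ≤ ∑ p, separationCount h C i p := by
  have hgn : C.card ≤ Fintype.card V := card_le_univ C
  set M := splitCount (Fintype.card V) i with hM
  set N := avoidCount (Fintype.card V) 2 2 i with hN
  have hNM : N ≤ M := Nat.le_add_right _ _
  have h1 : (Fintype.card V - C.card) * (2 * M) ≤
      ∑ u ∈ Cᶜ, ∑ v ∈ C, separationCount h C i (u, v) := by
    rw [← card_compl, ← smul_eq_mul]
    exact card_nsmul_le_sum _ _ _ fun u hu => hC.two_mul_splitCount_le hg (mem_compl.1 hu) i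
  have h2 : C.card * ((C.card - 3) * (if C.card = 4 then N else M)) ≤
      ∑ u ∈ C, ∑ v ∈ C, separationCount h C i (u, v) := by
    rw [← smul_eq_mul]
    exact card_nsmul_le_sum _ _ _ fun u hu => hC.mul_le_sum_separationCount hg hu i
  have h3 : ∑ u ∈ Cᶜ, ∑ v ∈ C, separationCount h C i (u, v) =
      ∑ u ∈ C, ∑ v ∈ Cᶜ, separationCount h C i (u, v) := by
    rw [sum_comm]
    exact sum_congr rfl fun u _ => sum_congr rfl fun v _ => separationCount_swap _ _ _ _ _
  -- Pairs with both members off the cycle are discarded; mixed pairs count twice by symmetry.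
  have h4 : ∑ u ∈ C, ∑ v ∈ C, separationCount h C i (u, v) +
      2 * ∑ u ∈ Cᶜ, ∑ v ∈ C, separationCount h C i (u, v) ≤ ∑ p, separationCount h C i p := by
    rw [Fintype.sum_prod_type, ← sum_add_sum_compl C, two_mul]
    conv_lhs => rw [← add_assoc]
    refine add_le_add ?_ (sum_le_sum fun u _ => sum_le_sum_of_subset (subset_univ _))
    rw [h3, ← sum_add_distrib]
    exact (sum_congr rfl fun u _ => sum_add_sum_compl C _).le
  refine le_trans ?_ h4
  refine le_trans ?_ (add_le_add h2 (Nat.mul_le_mul_left 2 h1))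
  obtain ⟨r, hr⟩ := Nat.exists_eq_add_of_le hgn
  obtain ⟨g, hg'⟩ := Nat.exists_eq_add_of_le hg
  rw [hr, hg']
  rcases Nat.eq_zero_or_pos g with rfl | hpos
  · simp only [add_zero, if_true, Nat.add_sub_cancel_left]
    apply le_of_eq
    norm_num
    ring
  -- Here the girth is `4 + g`, and the claim follows from `N ≤ M` and `(4 + g) * (g + 1) ≥ 4 * g +
  -- 4`.
  · rw [if_neg (by omega), show 4 + g + r - 4 = g + r by omega, show 4 + g - 3 = g + 1 by omega,
      show 4 + g + r - (4 + g) = r by omega]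
    nlinarith [Nat.mul_le_mul_left 4 hNM, Nat.zero_le (g * M), Nat.zero_le (g * g * M)]

end IsParentCycle

end ParentCycle

/-! ### Signless Laplacian coefficients through a parent map -/

namespace SimpleGraph

section ParentMap

variable {V : Type*}

theorem _root_.injective_sym2_mk_map {h : V → V} (hh : ∀ v, h (h v) ≠ v) :
    Function.Injective fun v => s(v, h v) := by
  intro v w hvw
  rcases Sym2.eq_iff.1 hvw with ⟨e, -⟩ | ⟨e1, e2⟩
  · exact e
  · refine (hh w ?_).elim
    rw [← e1]
    exact e2

/-- The edges of `G` are exactly the pairs `{v, h v}`, and these are pairwise distinct. -/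
structure IsParentMap (G : SimpleGraph V) (h : V → V) : Prop where
  adj_iff : ∀ u v, G.Adj u v ↔ h u = v ∨ h v = u
  map_map_ne : ∀ v, h (h v) ≠ v

namespace IsParentMap

variable {G : SimpleGraph V} {h : V → V}

theorem edge_injective (hG : G.IsParentMap h) : Function.Injective fun v => s(v, h v) :=
  injective_sym2_mk_map hG.map_map_ne

theorem mem_edgeSet_iff (hG : G.IsParentMap h) (e : Sym2 V) :
    e ∈ G.edgeSet ↔ ∃ v, s(v, h v) = e := by
  induction e using Sym2.ind with
  | _ a b =>
    rw [mem_edgeSet, hG.adj_iff]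
    constructor
    · rintro (rfl | rfl)
      · exact ⟨a, rfl⟩
      · exact ⟨b, Sym2.eq_swap⟩
    · rintro ⟨v, hv⟩
      rcases Sym2.eq_iff.1 hv with ⟨rfl, rfl⟩ | ⟨rfl, rfl⟩ <;> simp

variable [DecidableEq V]

theorem parentIncMatrix_eq (hG : G.IsParentMap h) [DecidableRel G.Adj] (w v : V) :
    parentIncMatrix h w v = G.incMatrix ℝ w s(v, h v) := by
  have hne : v ≠ h v := ((hG.adj_iff v (h v)).2 (Or.inl rfl)).ne
  have : s(v, h v) ∈ G.incidenceSet w ↔ w = v ∨ w = h v := by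
    rw [mk'_mem_incidenceSet_iff]
    exact and_iff_right ((hG.adj_iff v (h v)).2 (Or.inl rfl))
  rw [incMatrix_apply', parentIncMatrix, of_apply]
  simp only [this]
  by_cases h1 : w = v
  · subst h1; simp [hne]
  · simp [h1]

variable [Fintype V]

theorem card_edgeFinset (hG : G.IsParentMap h) [DecidableRel G.Adj] :
    G.edgeFinset.card = Fintype.card V := by
  rw [← card_univ, ← card_image_of_injective univ hG.edge_injective]
  congr 1
  ext e
  simp [mem_edgeFinset, hG.mem_edgeSet_iff]

theorem signlessLapMatrix_eq (hG : G.IsParentMap h) [DecidableRel G.Adj] :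
    G.signlessLapMatrix = parentIncMatrix h * (parentIncMatrix h)ᵀ := by
  have h1 : G.signlessLapMatrix = G.incMatrix ℝ * (G.incMatrix ℝ)ᵀ := by
    rw [incMatrix_mul_transpose]
    ext a b
    rw [signlessLapMatrix, Matrix.add_apply, degMatrix, diagonal_apply, adjMatrix_apply, of_apply]
    split_ifs with hab hadj <;> simp_all
  rw [h1]
  ext a b
  rw [mul_apply, mul_apply]
  simp only [transpose_apply, hG.parentIncMatrix_eq]
  rw [← sum_image (f := fun e => G.incMatrix ℝ a e * G.incMatrix ℝ b e)
    (fun v _ w _ e => hG.edge_injective e)]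
  symm
  -- `incMatrix` has a column for every element of `Sym2 V`; those of non-edges are zero.
  refine sum_subset (subset_univ _) fun e _ he => ?_
  have : e ∉ G.edgeSet := by
    rw [hG.mem_edgeSet_iff]
    simpa using he
  rw [incMatrix_of_notMem_incidenceSet, zero_mul]
  exact fun h' => this h'.1

theorem signlessLapCoeff_eq_sum (hG : G.IsParentMap h) [DecidableRel G.Adj] {i : ℕ}
    (hi : i ≤ Fintype.card V) :
    G.signlessLapCoeff i = ∑ F ∈ powersetCard i univ,
      (((parentIncMatrix h)ᵀ * parentIncMatrix h).submatrix
        (Subtype.val : F → V) Subtype.val).det := by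
  rw [signlessLapCoeff, hG.signlessLapMatrix_eq, charpoly_mul_comm,
    charpoly_coeff_eq_sum_minors _ _ hi, ← mul_assoc, ← mul_pow]
  simp

end IsParentMap

variable [Fintype V] [DecidableEq V]

/-- Double counting of incidences between edge sets and the pairs they separate. -/
theorem _root_.sum_card_separatedPairs (h : V → V) (C : Finset V) (i : ℕ) :
    ∑ F ∈ (powersetCard i univ).filter (¬ C ⊆ ·), (separatedPairs h F).card =
      ∑ p, separationCount h C i p := by
  have := sum_card_bipartiteAbove_eq_sum_card_bipartiteBelow
    (s := (powersetCard i (univ : Finset V)).filter (¬ C ⊆ ·)) (t := (univ : Finset (V × V)))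
    (fun F p => p ∈ separatedPairs h F)
  convert this using 2 with F _ p
  · congr 1; ext; simp [bipartiteAbove]
  · rw [separationCount, bipartiteBelow, filter_filter]

theorem _root_.sum_filter_one_add_card_separatedPairs (h : V → V) (C : Finset V) (i : ℕ) :
    ∑ F ∈ (powersetCard i univ).filter (¬ C ⊆ ·),
      (1 + (F.card : ℝ) + ((separatedPairs h F).card : ℝ) / 2) =
      (((powersetCard i univ).filter (¬ C ⊆ ·)).card : ℝ) * (1 + i) +
        ((∑ p, separationCount h C i p : ℕ) : ℝ) / 2 := by
  rw [sum_add_distrib, ← sum_div, ← sum_card_separatedPairs]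
  push_cast
  congr 1
  rw [← nsmul_eq_mul, ← sum_const]
  refine sum_congr rfl fun F hF => ?_
  rw [(mem_powersetCard.1 (mem_filter.1 hF).1).2]

theorem _root_.card_filter_not_subset (T : Finset V) (i : ℕ) :
    (((powersetCard i univ).filter (¬ T ⊆ ·)).card : ℝ) =
      (Fintype.card V).choose i - avoidCount (Fintype.card V) T.card 0 i := by
  have h1 := card_filter_add_card_filter_not (s := powersetCard i (univ : Finset V)) (T ⊆ ·)
  have h2 := card_filter_subset_disjoint T ∅ (disjoint_empty_right _) i
  simp only [disjoint_empty_left, and_true, card_empty] at h2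
  rw [h2, card_powersetCard, card_univ] at h1
  rw [← h1]
  push_cast
  ring

/-- A lower bound for the signless Laplacian coefficients of unicyclic graphs of order `n` and
girth at least `4`, attained by `pendentC4 n`. -/
noncomputable def _root_.unicyclicBound (n i : ℕ) : ℝ :=
  (n.choose i - avoidCount n 4 0 i) * (1 + i) +
    ((4 * (n - 4) * splitCount n i + 4 * avoidCount n 2 2 i : ℕ) : ℝ) / 2

theorem IsParentMap.unicyclicBound_le {G : SimpleGraph V} {h : V → V} {C : Finset V}
    (hG : G.IsParentMap h) (hC : IsParentCycle h C) (hg : 4 ≤ C.card) [DecidableRel G.Adj] {i : ℕ}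
    (hi : i ≤ Fintype.card V) : unicyclicBound (Fintype.card V) i ≤ G.signlessLapCoeff i := by
  -- A set missing an element of a 4-subset `T` of `C` also misses one of `C`, so longer cycles only
  -- enlarge the family of admissible `F`.
  obtain ⟨T, hTC, hT⟩ := exists_subset_card_eq hg
  have h1 : ∑ F ∈ (powersetCard i univ).filter (¬ C ⊆ ·),
      (1 + (F.card : ℝ) + ((separatedPairs h F).card : ℝ) / 2) ≤ G.signlessLapCoeff i := by
    rw [hG.signlessLapCoeff_eq_sum hi]
    refine le_trans (sum_le_sum fun F hF => ?_) (sum_le_sum_of_subset_of_nonneg (filter_subset _ _)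
      fun F _ _ => det_gram_nonneg h F)
    exact le_det_gram (hC.exits (mem_filter.1 hF).2)
  refine le_trans ?_ h1
  rw [sum_filter_one_add_card_separatedPairs, unicyclicBound]
  have h2 : (((powersetCard i univ).filter (¬ T ⊆ ·)).card : ℝ) ≤
      ((powersetCard i univ).filter (¬ C ⊆ ·)).card := by
    refine Nat.cast_le.2 (card_le_card fun F hF => ?_)
    rw [mem_filter] at hF ⊢
    exact ⟨hF.1, fun h' => hF.2 (hTC.trans h')⟩
  rw [card_filter_not_subset, hT] at h2
  have h3 : ((4 * (Fintype.card V - 4) * splitCount (Fintype.card V) i +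
      4 * avoidCount (Fintype.card V) 2 2 i : ℕ) : ℝ) ≤
      ((∑ p, separationCount h C i p : ℕ) : ℝ) := by
    exact_mod_cast hC.le_sum_separationCount hg i
  have h4 : (0 : ℝ) ≤ 1 + i := by positivity
  gcongr

end ParentMap

/-! ### Constructing the parent map of a unicyclic graph -/

section Unicyclic

variable {V : Type*} [Fintype V] [DecidableEq V]

/-- Take a shortest cycle, step along it, and elsewhere step to a neighbour closer to its base point
`r`. No edge is traversed both ways, so this yields as many distinct edges as vertices, hence all
edges. -/
theorem IsUnicyclic.exists_parentMap {G : SimpleGraph V} [DecidableRel G.Adj]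
    (hG : G.IsUnicyclic) :
    ∃ (h : V → V) (C : Finset V), G.IsParentMap h ∧ IsParentCycle h C ∧ C.card = G.girth := by
  obtain ⟨hconn, hcard⟩ := hG
  have hcyc : ¬ G.IsAcyclic := fun hac => by
    have := IsTree.card_edgeFinset (G := G) ⟨hconn, hac⟩
    omega
  obtain ⟨r, w, hw, hlen⟩ := exists_girth_eq_length.2 hcyc
  have hl3 := hw.three_le_length
  set g := w.length with hg
  have hinj : ∀ {a b}, a < g → b < g → w.getVert a = w.getVert b → a = b := fun ha hb e =>
    hw.getVert_injOn' (by simp only [Set.mem_ofPred_eq]; omega)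
      (by simp only [Set.mem_ofPred_eq]; omega) e
  have h0 : w.getVert 0 = r := w.getVert_zero
  have hgr : w.getVert g = r := w.getVert_length
  have hg0 : w.getVert g = w.getVert 0 := hgr.trans h0.symm
  let C : Finset V := (range g).image w.getVert
  have hCcard : C.card = g := by
    rw [card_image_of_injOn, card_range]
    exact fun a ha b hb => hinj (by simpa using ha) (by simpa using hb)
  -- the parent of a vertex: the next one on the cycle, or a neighbour that is closer to `r`
  have hnext : ∀ v, ∃ v', G.Adj v v' ∧ (∀ j < g, w.getVert j = v → v' = w.getVert (j + 1)) ∧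
      (v ∉ C → G.dist v' r < G.dist v r) := by
    intro v
    by_cases hv : v ∈ C
    · obtain ⟨j, hj, rfl⟩ := mem_image.1 hv
      rw [mem_range] at hj
      refine ⟨w.getVert (j + 1), w.adj_getVert_succ hj, fun k hk e => ?_, fun h' => absurd hv h'⟩
      rw [hinj hk hj e]
    · obtain ⟨p, hp⟩ := hconn.exists_walk_length_eq_dist v r
      cases p with
      | nil =>
        exact absurd (mem_image.2 ⟨0, mem_range.2 (by omega), h0⟩) hv
      | @cons _ v' _ hadj q =>
        refine ⟨v', hadj, fun j hj e => absurd (mem_image.2 ⟨j, mem_range.2 hj, e⟩) hv, fun _ => ?_⟩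
        rw [← hp, Walk.length_cons]
        exact Nat.lt_succ_of_le (dist_le q)
  choose h hadj hcycle hdist using hnext
  have hh : ∀ j < g, h (w.getVert j) = w.getVert (j + 1) := fun j hj => hcycle _ j hj rfl
  have hmap : ∀ z ∈ C, h z ∈ C := by
    intro z hz
    obtain ⟨j, hj, rfl⟩ := mem_image.1 hz
    rw [mem_range] at hj
    rw [hh j hj]
    rcases Nat.lt_or_ge (j + 1) g with h1 | h1
    · exact mem_image.2 ⟨j + 1, mem_range.2 h1, rfl⟩
    · rw [show j + 1 = g by omega, hg0]
      exact mem_image.2 ⟨0, mem_range.2 (by omega), rfl⟩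
  have hhne : ∀ v, h (h v) ≠ v := by
    intro v e
    by_cases hv : v ∈ C
    · obtain ⟨j, hj, rfl⟩ := mem_image.1 hv
      rw [mem_range] at hj
      rw [hh j hj] at e
      rcases Nat.lt_or_ge (j + 1) g with h1 | h1
      · rw [hh _ h1] at e
        rcases Nat.lt_or_ge (j + 1 + 1) g with h2 | h2
        · have := hinj h2 hj e; omega
        · have h3 : j + 1 + 1 = g := by omega
          rw [h3, hg0] at e
          have := hinj (by omega) hj e; omega
      · have h3 : j + 1 = g := by omega
        rw [h3, hg0, hh 0 (by omega)] at e
        have := hinj (by omega) hj e; omega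
    · have h1 := hdist v hv
      by_cases hv' : h v ∈ C
      · exact hv (e ▸ hmap _ hv')
      · have h2 := hdist _ hv'
        rw [e] at h2
        omega
  have hiter : ∀ j ≤ g, h^[j] r = w.getVert j := by
    intro j
    induction j with
    | zero => intro _; exact h0.symm
    | succ j ih =>
      intro hj
      rw [Function.iterate_succ_apply', ih (by omega), hh j (by omega)]
  have hper : Function.minimalPeriod h r = g := by
    have hp : Function.IsPeriodicPt h g r := (hiter g le_rfl).trans hgr
    refine le_antisymm (hp.minimalPeriod_le (by omega)) ?_
    by_contra hlt
    rw [not_le] at hlt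
    have h1 : h^[Function.minimalPeriod h r] r = r := Function.iterate_minimalPeriod
    rw [hiter _ hlt.le] at h1
    have h2 := hinj hlt (by omega) (h1.trans h0.symm)
    have h3 := hp.minimalPeriod_pos (by omega)
    omega
  refine ⟨h, C, ⟨?_, hhne⟩, ⟨hmap, ?_, ?_⟩, hCcard.trans hlen.symm⟩
  · have hinjE := injective_sym2_mk_map hhne
    have himg : univ.image (fun v => s(v, h v)) = G.edgeFinset := by
      refine eq_of_subset_of_card_le ?_ ?_
      · intro e he
        obtain ⟨v, -, rfl⟩ := mem_image.1 he
        rw [mem_edgeFinset]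
        exact hadj v
      · rw [card_image_of_injective _ hinjE, card_univ, hcard]
    intro u v
    constructor
    · intro huv
      have : s(u, v) ∈ G.edgeFinset := mem_edgeFinset.2 huv
      rw [← himg] at this
      obtain ⟨x, -, hx⟩ := mem_image.1 this
      rcases Sym2.eq_iff.1 hx with ⟨rfl, rfl⟩ | ⟨rfl, rfl⟩ <;> simp
    · rintro (rfl | rfl)
      · exact hadj u
      · exact (hadj v).symm
  · intro z hz
    obtain ⟨j, hj, rfl⟩ := mem_image.1 hz
    rw [mem_range] at hj
    rw [← hiter j hj.le, Function.minimalPeriod_apply_iterate, hper, hCcard]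
    exact Function.minimalPeriod_pos_iff_mem_periodicPts.1 (by omega)
  · intro v
    induction hd : G.dist v r using Nat.strong_induction_on generalizing v with
    | _ d ih =>
      by_cases hv : v ∈ C
      · exact ⟨0, hv⟩
      · obtain ⟨k, hk⟩ := ih _ (hd ▸ hdist v hv) (h v) rfl
        exact ⟨k + 1, by rwa [Function.iterate_succ_apply]⟩

end Unicyclic

end SimpleGraph

/-! ### The extremal graph: minors and sharpness -/

section ExitPred

variable {V : Type*} {h : V → V} {F : Finset V} {v : V}

/-- The witness is the last point of the orbit before it leaves `F`. -/
theorem exists_mem_map_eq_exitPt (hF : ∃ k, h^[k] v ∉ F) (hv : v ∈ F) :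
    ∃ w ∈ F, h w = exitPt h F v := by
  have h1 := exitTime_of_mem hF hv
  refine ⟨h^[exitTime h F (h v)] v, ?_, ?_⟩
  · by_contra hn
    have := exitTime_le hn
    omega
  · rw [exitPt, h1, Function.iterate_succ_apply']

end ExitPred

namespace pendentC4

variable {n : ℕ} (hn : 4 ≤ n)

/-- The vertex `j` of the cycle of `pendentC4 n`. -/
def cycleVertex (j : Fin 4) : Fin n := Fin.castLE hn j

/-- The parent map of `pendentC4 n`, running around the cycle. -/
def parent (v : Fin n) : Fin n :=
  if v.val = 0 then cycleVertex hn 1 else if v.val = 1 then cycleVertex hn 2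
  else if v.val = 2 then cycleVertex hn 3 else cycleVertex hn 0

/-- The vertices of the cycle of `pendentC4 n`. -/
def cycle : Finset (Fin n) :=
  {cycleVertex hn 0, cycleVertex hn 1, cycleVertex hn 2, cycleVertex hn 3}

theorem val_parent (v : Fin n) : (parent hn v).val =
    if v.val = 0 then 1 else if v.val = 1 then 2 else if v.val = 2 then 3 else 0 := by
  unfold parent
  split_ifs <;> rfl

theorem cycleVertex_injective : Function.Injective (cycleVertex hn) :=
  Fin.castLE_injective hn

theorem mem_cycle {v : Fin n} : v ∈ cycle hn ↔ v.val < 4 := by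
  simp only [cycle, mem_insert, mem_singleton, Fin.ext_iff, cycleVertex, Fin.val_castLE,
    Fin.isValue]
  norm_num
  omega

theorem card_cycle : (cycle hn).card = 4 := by
  have : cycle hn = univ.image (cycleVertex hn) := by
    ext v
    simp [cycle, Fin.exists_fin_succ, eq_comm]
  rw [this, card_image_of_injective _ (cycleVertex_injective hn), card_univ, Fintype.card_fin]

theorem isParentMap : (pendentC4 n).IsParentMap (parent hn) where
  adj_iff u v := by
    rw [pendentC4, SimpleGraph.fromRel_adj, Fin.ext_iff, Fin.ext_iff, val_parent, val_parent, Ne,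
      Fin.ext_iff]
    split_ifs <;> omega
  map_map_ne v := by
    have h1 := val_parent hn v
    have h2 := val_parent hn (parent hn v)
    rw [Ne, Fin.ext_iff]
    split_ifs at h1 h2 <;> omega

theorem parent_mem_cycle (v : Fin n) : parent hn v ∈ cycle hn := by
  rw [mem_cycle, val_parent]
  split_ifs <;> omega

theorem isParentCycle : IsParentCycle (parent hn) (cycle hn) where
  map_mem z _ := parent_mem_cycle hn z
  minimalPeriod_eq z hz := by
    rw [mem_cycle] at hz
    have h4 : Function.IsPeriodicPt (parent hn) 4 z := by
      have hj : ∀ j : Fin 4, Function.IsPeriodicPt (parent hn) 4 (cycleVertex hn j) := by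
        intro j
        fin_cases j <;> rfl
      exact hj ⟨z.val, hz⟩
    have h2 : ¬ Function.IsPeriodicPt (parent hn) 2 z := (isParentMap hn).map_map_ne z
    rw [Function.isPeriodicPt_iff_minimalPeriod_dvd] at h4 h2
    rw [card_cycle]
    have := Nat.le_of_dvd (by norm_num) h4
    interval_cases Function.minimalPeriod (parent hn) z <;> omega
  reaches v := ⟨1, parent_mem_cycle hn v⟩

theorem isUnicyclic {n : ℕ} (hn : 4 ≤ n) : (pendentC4 n).IsUnicyclic := by
  refine ⟨?_, by rw [(isParentMap hn).card_edgeFinset]⟩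
  have hadj : ∀ v, (pendentC4 n).Reachable v (parent hn v) := fun v =>
    (((isParentMap hn).adj_iff v _).2 (Or.inl rfl)).reachable
  have key : ∀ v, (pendentC4 n).Reachable v (cycleVertex hn 0) := by
    have h3 : ∀ v : Fin n, 3 ≤ v.val → (pendentC4 n).Reachable v (cycleVertex hn 0) := by
      intro v hv
      have := hadj v
      rwa [parent, if_neg (by omega), if_neg (by omega), if_neg (by omega)] at this
    have h2 : ∀ v : Fin n, 2 ≤ v.val → (pendentC4 n).Reachable v (cycleVertex hn 0) := by
      intro v hv
      by_cases h : v.val = 2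
      · exact (hadj v).trans (h3 _ (by rw [val_parent]; simp [h]))
      · exact h3 v (by omega)
    intro v
    by_cases h0 : v.val = 0
    · rw [show v = cycleVertex hn 0 from Fin.ext h0]
    · by_cases h : v.val = 1
      · exact (hadj v).trans (h2 _ (by rw [val_parent]; simp [h]))
      · exact h2 v (by omega)
  have : Nonempty (Fin n) := ⟨cycleVertex hn 0⟩
  exact SimpleGraph.Connected.mk fun u v => (key u).trans (key v).symm

theorem even_girth (n : ℕ) : Even (pendentC4 n).girth := by
  by_cases hac : (pendentC4 n).IsAcyclic
  -- An acyclic graph has girth `0` by convention, which is even; otherwise a 2-colouring forces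
  -- even cycle length.
  · rw [SimpleGraph.girth_eq_zero.2 hac]
    exact Even.zero
  · obtain ⟨v, w, -, hlen⟩ := SimpleGraph.exists_girth_eq_length.2 hac
    let c : (pendentC4 n).Coloring Bool :=
      SimpleGraph.Coloring.mk (fun v => decide (v.val = 0 ∨ v.val = 2)) (by
        intro a b hab
        rw [pendentC4, SimpleGraph.fromRel_adj] at hab
        rw [Ne, decide_eq_decide]
        omega)
    rw [hlen, c.even_length_iff_congr]

theorem det_gram_eq {F : Finset (Fin n)} (hF : ¬ cycle hn ⊆ F) :
    (((parentIncMatrix (parent hn))ᵀ * parentIncMatrix (parent hn)).submatrix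
      (Subtype.val : F → Fin n) Subtype.val).det =
    1 + (F.card : ℝ) + ((separatedPairs (parent hn) F).card : ℝ) / 2 := by
  have hex := (isParentCycle hn).exits hF
  rw [det_gram_eq_prod hex, card_separatedPairs, ← sum_card_fibers (parent hn) F]
  set c : Fin n → ℝ := fun r => ((F.filter (exitPt (parent hn) F · = r)).card : ℝ) with hc
  have hpred : ∀ r, c r ≠ 0 → r ∉ F ∧ ∃ w ∈ F, parent hn w = r := by
    intro r hr
    obtain ⟨v, hv⟩ := card_ne_zero.1 (Nat.cast_ne_zero.1 hr)
    obtain ⟨hvF, rfl⟩ := mem_filter.1 hv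
    exact ⟨exitPt_notMem (hex v), exists_mem_map_eq_exitPt (hex v) hvF⟩
  have h0 : ∀ r ∉ cycle hn, c r = 0 := by
    intro r hr
    by_contra hne
    obtain ⟨-, w, -, rfl⟩ := hpred r hne
    exact hr (parent_mem_cycle hn w)
  -- An orbit exiting at `b` passes through its only preimage `a`, so `a ∈ F` and nothing exits at
  -- `a`. This applies to `(0, 1)` and `(2, 3)`, killing all terms of degree three and four in the
  -- product.
  have hnext : ∀ a b : Fin n, (∀ w, parent hn w = b → w = a) → c a * c b = 0 := by
    intro a b hab
    by_contra hne
    obtain ⟨h1, h2⟩ := mul_ne_zero_iff.1 hne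
    obtain ⟨-, w, hw, e⟩ := hpred b h2
    exact (hpred a h1).1 (hab w e ▸ hw)
  have h01 : c (cycleVertex hn 0) * c (cycleVertex hn 1) = 0 := hnext _ _ fun w hw => by
    have := congrArg Fin.val hw
    rw [val_parent] at this
    change _ = 1 at this
    apply Fin.ext
    change _ = 0
    split_ifs at this <;> omega
  have h23 : c (cycleVertex hn 2) * c (cycleVertex hn 3) = 0 := hnext _ _ fun w hw => by
    have := congrArg Fin.val hw
    rw [val_parent] at this
    change _ = 3 at this
    apply Fin.ext
    change _ = 2
    split_ifs at this <;> omega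
  change ∏ r, (1 + c r) = 1 + ∑ r, c r + ((∑ r, c r) ^ 2 - ∑ r, c r ^ 2) / 2
  have hp : ∏ r, (1 + c r) = ∏ r ∈ cycle hn, (1 + c r) :=
    (prod_subset (subset_univ _) fun r _ hr => by rw [h0 r hr, add_zero]).symm
  have hs : ∑ r, c r = ∑ r ∈ cycle hn, c r :=
    (sum_subset (subset_univ _) fun r _ hr => h0 r hr).symm
  have hs2 : ∑ r, c r ^ 2 = ∑ r ∈ cycle hn, c r ^ 2 :=
    (sum_subset (subset_univ _) fun r _ hr => by rw [h0 r hr]; norm_num).symm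
  have hne : ∀ i j : Fin 4, i ≠ j → cycleVertex hn i ≠ cycleVertex hn j := fun i j hij =>
    (cycleVertex_injective hn).ne hij
  have hm0 : cycleVertex hn 0 ∉ ({cycleVertex hn 1, cycleVertex hn 2, cycleVertex hn 3} :
      Finset (Fin n)) := by simp [hne]
  have hm1 : cycleVertex hn 1 ∉ ({cycleVertex hn 2, cycleVertex hn 3} : Finset (Fin n)) := by
    simp [hne]
  have hm2 : cycleVertex hn 2 ∉ ({cycleVertex hn 3} : Finset (Fin n)) := by simp [hne]
  rw [hp, hs, hs2, cycle, prod_insert hm0, prod_insert hm1, prod_insert hm2, prod_singleton,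
    sum_insert hm0, sum_insert hm1, sum_insert hm2, sum_singleton,
    sum_insert hm0, sum_insert hm1, sum_insert hm2, sum_singleton]
  generalize c (cycleVertex hn 0) = x0 at *
  generalize c (cycleVertex hn 1) = x1 at *
  generalize c (cycleVertex hn 2) = x2 at *
  generalize c (cycleVertex hn 3) = x3 at *
  linear_combination (x2 + x3 + x2 * x3) * h01 + (x0 + x1) * h23

/-- The alternating vector on the edges of an even cycle lies in the kernel of the incidence matrix,
and it is supported in `F`. -/
theorem det_gram_eq_zero {F : Finset (Fin n)} (hF : cycle hn ⊆ F) :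
    (((parentIncMatrix (parent hn))ᵀ * parentIncMatrix (parent hn)).submatrix
      (Subtype.val : F → Fin n) Subtype.val).det = 0 := by
  let x : Fin n → ℝ := fun v => if v ∈ cycle hn then (-1) ^ v.val else 0
  have hx0 : ∀ v ∉ F, x v = 0 := fun v hv => if_neg fun h => hv (hF h)
  have hB : parentIncMatrix (parent hn) *ᵥ x = 0 := by
    have hne : ∀ i j : Fin 4, i ≠ j → cycleVertex hn i ≠ cycleVertex hn j := fun i j hij =>
      (cycleVertex_injective hn).ne hij
    have hm0 : cycleVertex hn 0 ∉ ({cycleVertex hn 1, cycleVertex hn 2, cycleVertex hn 3} :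
        Finset (Fin n)) := by simp [hne]
    have hm1 : cycleVertex hn 1 ∉ ({cycleVertex hn 2, cycleVertex hn 3} : Finset (Fin n)) := by
      simp [hne]
    have hm2 : cycleVertex hn 2 ∉ ({cycleVertex hn 3} : Finset (Fin n)) := by simp [hne]
    ext w
    have h1 : (parentIncMatrix (parent hn) *ᵥ x) w =
        ∑ v ∈ cycle hn, parentIncMatrix (parent hn) w v * (-1) ^ v.val := by
      rw [mulVec, dotProduct, ← sum_subset (subset_univ (cycle hn))]
      · exact sum_congr rfl fun v hv => by simp only [x, if_pos hv]
      · exact fun v _ hv => by simp only [x, if_neg hv, mul_zero]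
    have p0 : parent hn (cycleVertex hn 0) = cycleVertex hn 1 := rfl
    have p1 : parent hn (cycleVertex hn 1) = cycleVertex hn 2 := rfl
    have p2 : parent hn (cycleVertex hn 2) = cycleVertex hn 3 := rfl
    have p3 : parent hn (cycleVertex hn 3) = cycleVertex hn 0 := rfl
    have v0 : (cycleVertex hn 0).val = 0 := rfl
    have v1 : (cycleVertex hn 1).val = 1 := rfl
    have v2 : (cycleVertex hn 2).val = 2 := rfl
    have v3 : (cycleVertex hn 3).val = 3 := rfl
    rw [h1, cycle, sum_insert hm0, sum_insert hm1, sum_insert hm2, sum_singleton]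
    simp only [parentIncMatrix, of_apply, p0, p1, p2, p3, v0, v1, v2, v3, Pi.zero_apply]
    ring
  rw [← exists_mulVec_eq_zero_iff]
  refine ⟨fun v => x v, fun h => ?_, ?_⟩
  · have h0 : cycleVertex hn 0 ∈ cycle hn := by simp [cycle]
    have := congrFun h ⟨cycleVertex hn 0, hF h0⟩
    simp only [x, if_pos h0, Pi.zero_apply] at this
    exact pow_ne_zero _ (by norm_num) this
  · ext a
    have h1 : (((parentIncMatrix (parent hn))ᵀ * parentIncMatrix (parent hn)) *ᵥ x) a = 0 := by
      rw [← mulVec_mulVec, hB, mulVec_zero]; rfl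
    rw [mulVec, dotProduct, ← sum_subset (subset_univ F)
      (fun v _ hv => by rw [hx0 v hv, mul_zero]), ← sum_coe_sort F] at h1
    exact h1

theorem exitPt_facts {F : Finset (Fin n)} (hF : ¬ cycle hn ⊆ F) :
    (∀ v ∈ F, 3 ≤ v.val → exitPt (parent hn) F v = exitPt (parent hn) F (cycleVertex hn 0)) ∧
    ∀ j : Fin 4, cycleVertex hn j ∈ F → exitPt (parent hn) F (cycleVertex hn j) =
      exitPt (parent hn) F (cycleVertex hn (j + 1)) := by
  have hex := (isParentCycle hn).exits hF
  constructor
  · intro v hv h3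
    rw [exitPt_of_mem (hex v) hv, parent, if_neg (by omega), if_neg (by omega), if_neg (by omega)]
  · intro j hj
    rw [exitPt_of_mem (hex _) hj]
    fin_cases j <;> rfl

theorem card_compl_cycle : ((cycle hn)ᶜ).card = n - 4 := by
  rw [card_compl, card_cycle, Fintype.card_fin]

/-- Members of `F` with label at least 3 share the exit point of `0`, and a member of `F` on the
cycle shares that of its successor; this rules out every other pair. -/
theorem separatedPairs_cases {F : Finset (Fin n)} (hF : ¬ cycle hn ⊆ F) {u v : Fin n}
    (huv : (u, v) ∈ separatedPairs (parent hn) F) (hlt : v.val < u.val) :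
    (4 ≤ u.val ∧ v = cycleVertex hn 1 ∧ cycleVertex hn 0 ∉ F ∧
      (cycleVertex hn 2 ∉ F ∨ cycleVertex hn 3 ∉ F)) ∨
    (4 ≤ u.val ∧ v = cycleVertex hn 2 ∧ cycleVertex hn 3 ∉ F ∧
      (cycleVertex hn 0 ∉ F ∨ cycleVertex hn 1 ∉ F)) ∨
    (u = cycleVertex hn 2 ∧ v = cycleVertex hn 0 ∧ cycleVertex hn 1 ∉ F ∧ cycleVertex hn 3 ∉ F) ∨
    (u = cycleVertex hn 3 ∧ v = cycleVertex hn 1 ∧ cycleVertex hn 0 ∉ F ∧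
      cycleVertex hn 2 ∉ F) := by
  obtain ⟨hp, hc⟩ := exitPt_facts hn hF
  have e0 := hc 0
  have e1 := hc 1
  have e2 := hc 2
  have e3 := hc 3
  rw [show (0 : Fin 4) + 1 = 1 from rfl] at e0
  rw [show (1 : Fin 4) + 1 = 2 from rfl] at e1
  rw [show (2 : Fin 4) + 1 = 3 from rfl] at e2
  rw [show (3 : Fin 4) + 1 = 0 from rfl] at e3
  simp only [separatedPairs, mem_filter, mem_product] at huv
  obtain ⟨⟨hu, hv⟩, hne⟩ := huv
  have hcase : ∀ w : Fin n, w = cycleVertex hn 0 ∨ w = cycleVertex hn 1 ∨ w = cycleVertex hn 2 ∨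
      w = cycleVertex hn 3 ∨ 4 ≤ w.val := by
    intro w
    simp only [Fin.ext_iff]
    change w.val = 0 ∨ w.val = 1 ∨ w.val = 2 ∨ w.val = 3 ∨ _
    omega
  have v0 : (cycleVertex hn 0).val = 0 := rfl
  have v1 : (cycleVertex hn 1).val = 1 := rfl
  have v2 : (cycleVertex hn 2).val = 2 := rfl
  have v3 : (cycleVertex hn 3).val = 3 := rfl
  rcases hcase u with rfl | rfl | rfl | rfl | hu4 <;>
    rcases hcase v with rfl | rfl | rfl | rfl | hv4 <;> first | omega | grind

end pendentC4

/-! ### The extremal graph: counting separated pairs -/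

namespace pendentC4

variable {n : ℕ} (hn : 4 ≤ n)

theorem separationCount_le {u v : Fin n} (i : ℕ) (hlt : v.val < u.val) :
    separationCount (parent hn) (cycle hn) i (u, v) ≤
      if 4 ≤ u.val ∧ (v = cycleVertex hn 1 ∨ v = cycleVertex hn 2) then splitCount n i
      else if (u, v) = (cycleVertex hn 2, cycleVertex hn 0) ∨
        (u, v) = (cycleVertex hn 3, cycleVertex hn 1) then avoidCount n 2 2 i else 0 := by
  have hne : ∀ {i j : Fin 4}, i ≠ j → cycleVertex hn i ≠ cycleVertex hn j := fun hij =>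
    (cycleVertex_injective hn).ne hij
  have hmem : ∀ F ∈ (powersetCard i univ).filter
      (fun F => ¬ cycle hn ⊆ F ∧ (u, v) ∈ separatedPairs (parent hn) F),
      F ∈ powersetCard i univ ∧ u ∈ F ∧ v ∈ F ∧ ((4 ≤ u.val ∧ v = cycleVertex hn 1 ∧
        cycleVertex hn 0 ∉ F ∧ (cycleVertex hn 2 ∉ F ∨ cycleVertex hn 3 ∉ F)) ∨
      (4 ≤ u.val ∧ v = cycleVertex hn 2 ∧ cycleVertex hn 3 ∉ F ∧
        (cycleVertex hn 0 ∉ F ∨ cycleVertex hn 1 ∉ F)) ∨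
      (u = cycleVertex hn 2 ∧ v = cycleVertex hn 0 ∧ cycleVertex hn 1 ∉ F ∧
        cycleVertex hn 3 ∉ F) ∨
      (u = cycleVertex hn 3 ∧ v = cycleVertex hn 1 ∧ cycleVertex hn 0 ∉ F ∧
        cycleVertex hn 2 ∉ F)) := by
    intro F hF
    rw [mem_filter] at hF
    have h2 := hF.2.2
    simp only [separatedPairs, mem_filter, mem_product] at h2
    exact ⟨hF.1, h2.1.1, h2.1.2, separatedPairs_cases hn hF.2.1 hF.2.2 hlt⟩
  have hu : 4 ≤ u.val → ∀ j, u ≠ cycleVertex hn j := by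
    rintro h4 j rfl
    exact absurd j.2 (not_lt.2 h4)
  have hM : splitCount n i = splitCount (Fintype.card (Fin n)) i := by rw [Fintype.card_fin]
  have hN : avoidCount n 2 2 i = avoidCount (Fintype.card (Fin n)) 2 2 i := by
    rw [Fintype.card_fin]
  unfold separationCount
  split_ifs with h1 h2
  · obtain ⟨h4, rfl | rfl⟩ := h1
    · rw [hM, ← card_filter_mem_mem_notMem_or (hu h4 1) (hu h4 0) (hu h4 2) (hu h4 3)
        (hne (by decide)) (hne (by decide)) (hne (by decide)) (hne (by decide)) (hne (by decide))
        (hne (by decide))]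
      refine card_le_card fun F hF => ?_
      obtain ⟨hF1, h3, h5, h6⟩ := hmem F hF
      rw [mem_filter]
      refine ⟨hF1, h3, h5, ?_⟩
      rcases h6 with h6 | h6 | h6 | h6
      · exact h6.2.2
      · exact absurd h6.2.1 (hne (by decide))
      · exact absurd h6.1 (hu h4 _)
      · exact absurd h6.1 (hu h4 _)
    · rw [hM, ← card_filter_mem_mem_notMem_or (hu h4 2) (hu h4 3) (hu h4 0) (hu h4 1)
        (hne (by decide)) (hne (by decide)) (hne (by decide)) (hne (by decide)) (hne (by decide))
        (hne (by decide))]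
      refine card_le_card fun F hF => ?_
      obtain ⟨hF1, h3, h5, h6⟩ := hmem F hF
      rw [mem_filter]
      refine ⟨hF1, h3, h5, ?_⟩
      rcases h6 with h6 | h6 | h6 | h6
      · exact absurd h6.2.1 (hne (by decide))
      · exact h6.2.2
      · exact absurd h6.1 (hu h4 _)
      · exact absurd h6.1 (hu h4 _)
  · rw [Prod.mk.injEq, Prod.mk.injEq] at h2
    obtain ⟨rfl, rfl⟩ | ⟨rfl, rfl⟩ := h2
    · rw [hN, ← card_filter_mem_mem_notMem_notMem (hne (i := 2) (j := 0) (by decide))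
        (hne (j := 1) (by decide)) (hne (j := 3) (by decide)) (hne (by decide))
        (hne (by decide)) (hne (by decide))]
      refine card_le_card fun F hF => ?_
      obtain ⟨hF1, h3, h5, h6⟩ := hmem F hF
      rw [mem_filter]
      refine ⟨hF1, h3, h5, ?_⟩
      rcases h6 with h6 | h6 | h6 | h6
      · exact absurd h6.2.1 (hne (by decide))
      · exact absurd h6.2.1 (hne (by decide))
      · exact h6.2.2
      · exact absurd h6.1 (hne (by decide))
    · rw [hN, ← card_filter_mem_mem_notMem_notMem (hne (i := 3) (j := 1) (by decide))
        (hne (j := 0) (by decide)) (hne (j := 2) (by decide)) (hne (by decide))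
        (hne (by decide)) (hne (by decide))]
      refine card_le_card fun F hF => ?_
      obtain ⟨hF1, h3, h5, h6⟩ := hmem F hF
      rw [mem_filter]
      refine ⟨hF1, h3, h5, ?_⟩
      rcases h6 with h6 | h6 | h6 | h6
      · exact absurd rfl (hu h6.1 3)
      · exact absurd rfl (hu h6.1 3)
      · exact absurd h6.1 (hne (by decide))
      · exact h6.2.2
  · rw [Nat.le_zero, card_eq_zero, eq_empty_iff_forall_notMem]
    intro F hF
    obtain ⟨-, -, -, h6⟩ := hmem F hF
    rw [Prod.mk.injEq, Prod.mk.injEq] at h2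
    tauto

theorem sum_separationCount_le (i : ℕ) :
    ∑ p, separationCount (parent hn) (cycle hn) i p ≤
      4 * (n - 4) * splitCount n i + 4 * avoidCount n 2 2 i := by
  set f := separationCount (parent hn) (cycle hn) i with hf
  have hdiag : ∀ u, f (u, u) = 0 := by
    intro u
    simp [hf, separationCount, separatedPairs]
  have hlt : ∑ p ∈ univ.filter (fun p : Fin n × Fin n => p.2 < p.1), f p ≤
      2 * (n - 4) * splitCount n i + 2 * avoidCount n 2 2 i := by
    -- `A` pairs a pendent edge with one of the two cycle edges not at vertex `0`; `B` consists of
    -- the two pairs of opposite cycle edges.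
    let A : Finset (Fin n × Fin n) := (cycle hn)ᶜ ×ˢ {cycleVertex hn 1, cycleVertex hn 2}
    let B : Finset (Fin n × Fin n) :=
      {(cycleVertex hn 2, cycleVertex hn 0), (cycleVertex hn 3, cycleVertex hn 1)}
    have hA : A.card ≤ 2 * (n - 4) := by
      rw [card_product, card_compl_cycle, mul_comm]
      exact Nat.mul_le_mul_right _ card_le_two
    have hB : B.card ≤ 2 := card_le_two
    calc ∑ p ∈ univ.filter (fun p : Fin n × Fin n => p.2 < p.1), f p
        ≤ ∑ p ∈ univ.filter (fun p : Fin n × Fin n => p.2 < p.1),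
          ((if p ∈ A then splitCount n i else 0) + if p ∈ B then avoidCount n 2 2 i else 0) := by
          refine sum_le_sum fun p hp => ?_
          obtain ⟨u, v⟩ := p
          refine (separationCount_le hn i (mem_filter.1 hp).2).trans ?_
          simp only [A, B, mem_product, mem_compl, mem_cycle, not_lt, mem_insert, mem_singleton]
          split_ifs <;> omega
      _ ≤ ∑ p, ((if p ∈ A then splitCount n i else 0) +
            if p ∈ B then avoidCount n 2 2 i else 0) :=
          sum_le_sum_of_subset (subset_univ _)
      _ = A.card * splitCount n i + B.card * avoidCount n 2 2 i := by
          rw [sum_add_distrib, sum_ite_mem, sum_ite_mem, univ_inter, univ_inter, sum_const,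
            sum_const, smul_eq_mul, smul_eq_mul]
      _ ≤ _ := add_le_add (Nat.mul_le_mul_right _ hA) (Nat.mul_le_mul_right _ hB)
  have hgt : ∑ p ∈ univ.filter (fun p : Fin n × Fin n => p.1 < p.2), f p =
      ∑ p ∈ univ.filter (fun p : Fin n × Fin n => p.2 < p.1), f p := by
    refine sum_equiv (Equiv.prodComm _ _) (by simp) fun p _ => ?_
    exact separationCount_swap _ _ _ _ _
  have hsplit : ∑ p, f p = ∑ p ∈ univ.filter (fun p : Fin n × Fin n => p.2 < p.1), f p +
      ∑ p ∈ univ.filter (fun p : Fin n × Fin n => p.1 < p.2), f p := by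
    rw [sum_filter, sum_filter, ← sum_add_distrib]
    refine sum_congr rfl fun p _ => ?_
    obtain ⟨u, v⟩ := p
    rcases lt_trichotomy u v with h | rfl | h
    · simp [h, h.not_gt]
    · simp [hdiag]
    · simp [h, h.not_gt]
  rw [hsplit, hgt]
  calc _ ≤ (2 * (n - 4) * splitCount n i + 2 * avoidCount n 2 2 i) +
        (2 * (n - 4) * splitCount n i + 2 * avoidCount n 2 2 i) := add_le_add hlt hlt
    _ = _ := by ring

theorem signlessLapCoeff_le {n : ℕ} (hn : 4 ≤ n) {i : ℕ} (hi : i ≤ n) :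
    (pendentC4 n).signlessLapCoeff i ≤ unicyclicBound n i := by
  have hcard : Fintype.card (Fin n) = n := Fintype.card_fin n
  rw [(isParentMap hn).signlessLapCoeff_eq_sum (by rwa [hcard]),
    ← sum_filter_add_sum_filter_not _ (cycle hn ⊆ ·),
    sum_eq_zero fun F hF => det_gram_eq_zero hn (mem_filter.1 hF).2, zero_add,
    sum_congr rfl fun F hF => det_gram_eq hn (mem_filter.1 hF).2,
    sum_filter_one_add_card_separatedPairs, card_filter_not_subset, card_cycle, hcard,
    unicyclicBound]
  gcongr
  exact sum_separationCount_le hn i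

end pendentC4

theorem theorem5p2 (n : ℕ) (hn : 4 ≤ n) :
    ((pendentC4 n).IsUnicyclic ∧ Even (pendentC4 n).girth) ∧
      ∀ {V : Type*} [Fintype V] [DecidableEq V] (G : SimpleGraph V) [DecidableRel G.Adj],
        Fintype.card V = n → G.IsUnicyclic → Even G.girth →
          ∀ i : ℕ, i ≤ n → (pendentC4 n).signlessLapCoeff i ≤ G.signlessLapCoeff i := by
  refine ⟨⟨pendentC4.isUnicyclic hn, pendentC4.even_girth n⟩, ?_⟩
  intro V _ _ G _ hV hG heven i hi
  obtain ⟨h, C, hh, hC, hg⟩ := hG.exists_parentMap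
  -- A cycle has length at least 3, and even parity excludes 3.
  have h4 : 4 ≤ C.card := by
    have h3 : 3 ≤ G.girth := by
      refine SimpleGraph.three_le_girth fun hac => ?_
      have := SimpleGraph.IsTree.card_edgeFinset (G := G) ⟨hG.1, hac⟩
      have := hG.2
      omega
    obtain ⟨k, hk⟩ := heven
    omega
  refine (pendentC4.signlessLapCoeff_le hn hi).trans ?_
  have := hh.unicyclicBound_le hC h4 (hV.symm ▸ hi)
  rwa [hV] at this
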